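/- **Proposition ($\Lambda$ is a graded subring of $\mathrm{cQSym}$).** *Cyclic quasi-symmetric functions.* A series $f\in\mathbb{Q}[[x_1,x_2,\ldots]]$ is cyclic quasi-symmetric if for every sequence $(a_1,\ldots,a_s)$ of positive integers, every cyclic shift $(a'_1,\ldots,a'_s)$ of it, and all $i_1<\cdots<i_s$ and $j_1<\cdots<j_s$, the coefficients of $x_{i_1}^{a_1}\cdots x_{i_s}^{a_s}$ and $x_{j_1}^{a'_1}\cdots x_{j_s}^{a'_s}$ in $f$ are equal. Let $\mathrm{cQSym}_n$ be the space of those that are homogeneous of degree $n$, and let $\mathrm{cQSym}=\bigoplus_{n\ge 0}\mathrm{cQSym}_n$, a subring of $\mathbb{Q}[[x_1,x_2,\ldots]]$. *Enriched toric partitions.* Order the set $\mathbb{P}'$ of nonzero integers by $-1\prec 1\prec -2\prec 2\prec\cdots$. For a directed acyclic graph (DAG) $\vec D$ on $[n]=\{1,\dots,n\}$, an enriched $\vec D$-partition is a function $f:[n]\to\mathbb{P}'$ such that for every arrow $i\to j$ of $\vec D$: $f(i)\preceq f(j)$; $f(i)=f(j)>0$ implies $i<j$; and $f(i)=f(j)<0$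 implies $i>j$. A flip reverses all the arrows at a vertex that is a source or a sink, and $[\vec D]$ is the set of all DAGs obtained from $\vec D$ by sequences of flips. An enriched toric $[\vec D]$-partition is a function that is an enriched $\vec D'$-partition for at least one $\vec D'\in[\vec D]$. Put $\Delta^{\mathrm{cyc}}_{[\vec D]}=\sum_f\prod_{i\in[n]}x_{|f(i)|}$, summed over all enriched toric $[\vec D]$-partitions $f$. A permutation $w=w_1\cdots w_n\in\mathcal{S}_n$ is identified with the DAG with arrows $w_i\to w_j$ for all $i<j$, which defines $\Delta^{\mathrm{cyc}}_{[w]}$. *Cyclic peaks.* For $w\in\mathcal{S}_n$ let $\mathrm{cPk}\,w=\{i\in[n] : w_{i-1}<w_i>w_{i+1}\}$, with subscripts modulo $n$. A set $S\subseteq[n]$ is a cyclic peak set in $[n]$ if $S=\mathrm{cPk}\,w$ for some $w\in\mathcal{S}_n$; then $K^{\mathrm{cyc}}_S:=\Delta^{\mathrm{cyc}}_{[w]}$ for any such $w$. Let $\Lambda_n$ be the $\mathbb{Q}$-linear span of the $K^{\mathrm{cyc}}_S$ over the cyclic peak sets $S$ in $[n]$, and let $\Lambda=\bigoplus_{n\ge0}\Lambda_n$.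 *Claim.* The series $K^{\mathrm{cyc}}_S$ is well defined (it does not depend on the choice of $w$ with $\mathrm{cPk}\,w=S$), and $\Lambda$ is a graded subring (indeed a graded $\mathbb{Q}$-subalgebra) of $\mathrm{cQSym}$: the sum of the spaces $\Lambda_n$ is direct, $\Lambda_n\subseteq\mathrm{cQSym}_n$ for all $n\ge0$, $1\in\Lambda_0$, and $\Lambda_m\Lambda_n\subseteq\Lambda_{m+n}$ for all $m,n\ge 0$. -/

import Mathlib

namespace CyclicPeak

/-! ### Cyclic quasi-symmetric functions -/

/-- Formal power series over `ℚ` in the variables `x₁, x₂, …`. -/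
abbrev Series : Type := MvPowerSeries ℕ+ ℚ

/-- The exponent of the monomial `x_{i₁}^{a₁} ⋯ x_{i_s}^{a_s}`. -/
noncomputable def expo {s : ℕ} (i : Fin s → ℕ+) (a : Fin s → ℕ) : ℕ+ →₀ ℕ :=
  ∑ k, Finsupp.single (i k) (a k)

/-- `f` is cyclic quasi-symmetric: for every sequence `a` of positive integers, every cyclic
shift `a ∘ rot^c` of `a` and all increasing index sequences `i`, `j`, the coefficients of
`x_i^a` and `x_j^(a ∘ rot^c)` in `f` agree. -/
def IsCyclicQuasiSymmetric (f : Series) : Prop :=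
  ∀ (s : ℕ) (a : Fin s → ℕ), (∀ k, 0 < a k) → ∀ (c : ℕ) (i j : Fin s → ℕ+),
    StrictMono i → StrictMono j →
      MvPowerSeries.coeff (expo i a) f =
        MvPowerSeries.coeff (expo j (a ∘ (finRotate s)^[c])) f

lemma expo_delete {t : ℕ} (i : Fin (t + 1) → ℕ+) (a : Fin (t + 1) → ℕ)
    (p : Fin (t + 1)) (hp : a p = 0) :
    expo i a = expo (i ∘ p.succAbove) (a ∘ p.succAbove) := by
  simp [expo, Fin.sum_univ_succAbove _ p, hp]

lemma rotate_delete_zero {t : ℕ} (k : Fin t) :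
    finRotate (t + 1) ((Fin.last t).succAbove k) = (0 : Fin (t + 1)).succAbove k := by
  rw [Fin.succAbove_last, Fin.succAbove_zero]
  ext
  rw [coe_finRotate_of_ne_last (Fin.castSucc_lt_last k).ne]
  simp

lemma rotate_delete_succ {t : ℕ} (p : Fin t) (k : Fin t) :
    finRotate (t + 1) (p.castSucc.succAbove k) = p.succ.succAbove (finRotate t k) := by
  obtain _ | t := t
  · exact k.elim0
  ext
  rw [coe_finRotate]
  have hk := k.2
  have hp := p.2
  have h1 := coe_finRotate k
  simp only [Fin.succAbove, Fin.lt_def, Fin.ext_iff, Fin.val_last, Fin.val_castSucc,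
    Fin.val_succ] at h1 ⊢
  split_ifs at h1 ⊢ <;> simp_all <;> omega

/-- For a cyclic quasi-symmetric series, the exponents may also be zero. -/
lemma IsCyclicQuasiSymmetric.step {f : Series} (hf : IsCyclicQuasiSymmetric f) :
    ∀ (s : ℕ) (a : Fin s → ℕ) (i j : Fin s → ℕ+), StrictMono i → StrictMono j →
      MvPowerSeries.coeff (expo i a) f = MvPowerSeries.coeff (expo j a) f ∧
      MvPowerSeries.coeff (expo i a) f =
        MvPowerSeries.coeff (expo j (a ∘ finRotate s)) f := by
  intro s
  induction s with
  | zero =>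
    intro a i j hi hj
    simp [expo]
  | succ t ih =>
    intro a i j hi hj
    by_cases h : ∀ k, 0 < a k
    · exact ⟨hf _ a h 0 i j hi hj, hf _ a h 1 i j hi hj⟩
    · push Not at h
      obtain ⟨p, hp⟩ := h
      have hp0 : a p = 0 := by omega
      have hsi : ∀ q : Fin (t + 1), StrictMono (i ∘ q.succAbove) := fun q =>
        hi.comp (Fin.strictMono_succAbove q)
      have hsj : ∀ q : Fin (t + 1), StrictMono (j ∘ q.succAbove) := fun q =>
        hj.comp (Fin.strictMono_succAbove q)
      rw [expo_delete i a p hp0]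
      refine ⟨?_, ?_⟩
      · rw [expo_delete j a p hp0]
        exact (ih _ _ _ (hsi p) (hsj p)).1
      · induction p using Fin.cases with
        | zero =>
          rw [expo_delete j (a ∘ finRotate (t + 1)) (Fin.last t) (by simpa using hp0)]
          have : (a ∘ finRotate (t + 1)) ∘ (Fin.last t).succAbove
              = a ∘ (0 : Fin (t + 1)).succAbove := by
            funext k
            simp only [Function.comp]
            rw [rotate_delete_zero]
          rw [this]
          exact (ih _ _ _ (hsi _) (hsj _)).1
        | succ p =>
          have hq : finRotate (t + 1) p.castSucc = p.succ := by
            ext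
            rw [coe_finRotate_of_ne_last (Fin.castSucc_lt_last p).ne]
            simp
          rw [expo_delete j (a ∘ finRotate (t + 1)) p.castSucc
            (by simpa [Function.comp, hq] using hp0)]
          have : (a ∘ finRotate (t + 1)) ∘ p.castSucc.succAbove
              = (a ∘ p.succ.succAbove) ∘ finRotate t := by
            funext k
            simp only [Function.comp]
            rw [rotate_delete_succ]
          rw [this]
          exact (ih _ _ _ (hsi _) (hsj _)).2

lemma IsCyclicQuasiSymmetric.shift {f : Series} (hf : IsCyclicQuasiSymmetric f)
    {s : ℕ} (a : Fin s → ℕ) (c : ℕ) (i j : Fin s → ℕ+) (hi : StrictMono i)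
    (hj : StrictMono j) :
    MvPowerSeries.coeff (expo i a) f =
      MvPowerSeries.coeff (expo j (a ∘ (finRotate s)^[c])) f := by
  induction c generalizing a i with
  | zero => exact (hf.step s a i j hi hj).1
  | succ c ih =>
    rw [(hf.step s a i i hi hi).2, ih _ _ hi, Function.iterate_succ']
    rfl

lemma expo_eq_embDomain {s : ℕ} (u : Fin s ↪ ℕ+) (b : Fin s →₀ ℕ) :
    expo u b = b.embDomain u := by
  rw [Finsupp.embDomain_eq_mapDomain, Finsupp.mapDomain, Finsupp.sum_fintype _ _ (by simp)]
  rfl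

lemma coeff_mul_expo {s : ℕ} (u : Fin s ↪ ℕ+) (a : Fin s →₀ ℕ) (f g : Series) :
    MvPowerSeries.coeff (expo u a) (f * g) =
      ∑ b ∈ Finset.HasAntidiagonal.antidiagonal a,
        MvPowerSeries.coeff (expo u b.1) f * MvPowerSeries.coeff (expo u b.2) g := by
  classical
  rw [MvPowerSeries.coeff_mul]
  symm
  refine Finset.sum_bij (fun b _ => (expo u b.1, expo u b.2)) ?_ ?_ ?_ ?_
  · intro b hb
    rw [Finset.HasAntidiagonal.mem_antidiagonal] at hb ⊢
    simp only [expo, ← Finset.sum_add_distrib, ← Finsupp.single_add, ← hb, Finsupp.add_apply]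
  · intro b _ b' _ h
    simp only [expo_eq_embDomain, Prod.mk.injEq] at h
    exact Prod.ext (Finsupp.embDomain_injective u h.1) (Finsupp.embDomain_injective u h.2)
  · rintro ⟨p, q⟩ hpq
    rw [Finset.HasAntidiagonal.mem_antidiagonal] at hpq
    have key : ∀ r : ℕ+ →₀ ℕ, r ≤ expo u a →
        expo u (r.comapDomain u u.injective.injOn) = r := by
      intro r hr
      rw [expo_eq_embDomain]
      ext x
      by_cases hx : x ∈ Set.range u
      · obtain ⟨k, rfl⟩ := hx
        simp
      · rw [Finsupp.embDomain_of_notMem_range _ _ _ hx]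
        have := hr x
        rw [expo_eq_embDomain, Finsupp.embDomain_of_notMem_range _ _ _ hx] at this
        omega
    have hp : p ≤ expo u a := by rw [← hpq]; exact le_self_add
    have hq : q ≤ expo u a := by rw [← hpq]; exact le_add_self
    refine ⟨(p.comapDomain u u.injective.injOn, q.comapDomain u u.injective.injOn), ?_, ?_⟩
    · rw [Finset.HasAntidiagonal.mem_antidiagonal]
      ext k
      have := DFunLike.congr_fun hpq (u k)
      rw [expo_eq_embDomain, Finsupp.embDomain_apply_self] at this
      simpa using this
    · exact Prod.ext (key p hp) (key q hq)
  · intro b _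
    rfl

lemma expo_comp_perm {s : ℕ} (j : Fin s → ℕ+) (a : Fin s → ℕ)
    (σ : Equiv.Perm (Fin s)) : expo j (a ∘ σ) = expo (j ∘ σ.symm) a := by
  unfold expo
  refine (Equiv.sum_comp σ.symm _).symm.trans ?_
  simp

lemma IsCyclicQuasiSymmetric.mul {f g : Series} (hf : IsCyclicQuasiSymmetric f)
    (hg : IsCyclicQuasiSymmetric g) : IsCyclicQuasiSymmetric (f * g) := by
  intro s a _ c i j hi hj
  have hc : (finRotate s)^[c] = ((finRotate s) ^ c : Equiv.Perm (Fin s)) := by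
    rw [Equiv.Perm.coe_pow]
  let u : Fin s ↪ ℕ+ := ⟨i, hi.injective⟩
  let v : Fin s ↪ ℕ+ := ⟨j ∘ ((finRotate s) ^ c : Equiv.Perm (Fin s)).symm,
    hj.injective.comp (Equiv.injective _)⟩
  let a' : Fin s →₀ ℕ := Finsupp.equivFunOnFinite.symm a
  have h1 := coeff_mul_expo u a' f g
  have h2 := coeff_mul_expo v a' f g
  have ha : ⇑a' = a := rfl
  rw [hc, expo_comp_perm]
  rw [ha] at h1 h2
  change _ = MvPowerSeries.coeff (expo v a) (f * g)
  change MvPowerSeries.coeff (expo u a) (f * g) = _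
  rw [h1, h2]
  refine Finset.sum_congr rfl fun b _ => ?_
  have e : ∀ r : Fin s →₀ ℕ, expo v r = expo j (r ∘ (finRotate s)^[c]) := by
    intro r
    rw [hc, expo_comp_perm]
    rfl
  rw [e, e, ← hf.shift b.1 c i j hi hj, ← hg.shift b.2 c i j hi hj]
  rfl

/-- `cQSym_n`: the cyclic quasi-symmetric functions which are homogeneous of degree `n`. -/
noncomputable def cQSymDeg (n : ℕ) : Submodule ℚ Series where
  carrier := {f | IsCyclicQuasiSymmetric f ∧ f.IsHomogeneous n}
  zero_mem' := ⟨fun _ _ _ _ _ _ _ _ => by simp, by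
    intro d hd
    simp at hd⟩
  add_mem' := by
    rintro f g ⟨hf, hf'⟩ ⟨hg, hg'⟩
    exact ⟨fun s a ha c i j hi hj => by
      rw [map_add, map_add, hf s a ha c i j hi hj, hg s a ha c i j hi hj], MvPowerSeries.IsHomogeneous.add hf' hg'⟩
  smul_mem' := by
    rintro r f ⟨hf, hf'⟩
    refine ⟨fun s a ha c i j hi hj => ?_, ?_⟩
    · rw [map_smul, map_smul, hf s a ha c i j hi hj]
    · intro d hd
      apply hf'
      intro h
      apply hd
      rw [map_smul, h, smul_zero]

lemma one_mem_cQSymDeg : (1 : Series) ∈ cQSymDeg 0 := by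
  refine ⟨fun s a ha c i j _ _ => ?_, ?_⟩
  · obtain _ | s := s
    · simp [expo]
    · have key : ∀ (u : Fin (s + 1) → ℕ+) (b : Fin (s + 1) → ℕ), (∀ k, 0 < b k) →
          MvPowerSeries.coeff (expo u b) (1 : Series) = 0 := by
        intro u b hb
        rw [MvPowerSeries.coeff_one, if_neg]
        intro h
        have h' := DFunLike.congr_fun h (u 0)
        simp only [expo, Finsupp.finsetSum_apply, Finsupp.zero_apply,
          Finset.sum_eq_zero_iff] at h'
        have := h' 0 (Finset.mem_univ _)
        simp at this
        exact (hb 0).ne' this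
      rw [key i a ha]
      exact (key j _ (fun k => ha _)).symm
  · intro d hd
    rw [MvPowerSeries.coeff_one] at hd
    have : d = 0 := by
      by_contra h
      simp [h] at hd
    simp [this]

lemma mul_mem_cQSymDeg {m n : ℕ} {f g : Series} (hf : f ∈ cQSymDeg m) (hg : g ∈ cQSymDeg n) :
    f * g ∈ cQSymDeg (m + n) :=
  ⟨hf.1.mul hg.1, MvPowerSeries.IsHomogeneous.mul hf.2 hg.2⟩

/-- The ring `cQSym = ⊕ₙ cQSym_n` of cyclic quasi-symmetric functions, as a subalgebra of the
algebra of formal power series. -/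
noncomputable def cQSym : Subalgebra ℚ Series :=
  (⨆ n, cQSymDeg n).toSubalgebra (Submodule.mem_iSup_of_mem 0 one_mem_cQSymDeg) <| by
    intro f g hf hg
    have h := Submodule.mul_mem_mul hf hg
    rw [Submodule.iSup_mul] at h
    refine (iSup_le fun m => ?_ : _ ≤ ⨆ n, cQSymDeg n) h
    rw [Submodule.mul_iSup]
    refine iSup_le fun n => ?_
    rw [Submodule.mul_le]
    intro p hp q hq
    exact Submodule.mem_iSup_of_mem (m + n) (mul_mem_cQSymDeg hp hq)

/-! ### Enriched toric partitions -/

/-- The set `ℙ'` of nonzero integers. -/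
abbrev NonzeroInt : Type := {z : ℤ // z ≠ 0}

/-- The absolute value on `ℙ'`, as a positive integer. -/
def NonzeroInt.abs (z : NonzeroInt) : ℕ+ := ⟨z.1.natAbs, Int.natAbs_pos.mpr z.2⟩

/-- The total order `-1 ≺ 1 ≺ -2 ≺ 2 ≺ -3 ≺ 3 ≺ ⋯` on `ℙ'` (weak form). -/
def NonzeroInt.PrecEq (y z : NonzeroInt) : Prop :=
  y.abs < z.abs ∨ (y.abs = z.abs ∧ y.1 ≤ z.1)

/-- A directed acyclic graph with vertex set `[n]`; here `Fin n`, with its usual order, plays the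
role of `[n] = {1 < 2 < ⋯ < n}`. -/
structure DAG (n : ℕ) extends Digraph (Fin n) where
  acyclic : ∀ v, ¬ Relation.TransGen Adj v v

/-- `f` is an enriched `D`-partition. -/
def IsEnrichedPartition {n : ℕ} (D : DAG n) (f : Fin n → NonzeroInt) : Prop :=
  ∀ i j, D.Adj i j →
    (f i).PrecEq (f j) ∧
    (f i = f j → 0 < (f i).1 → i < j) ∧
    (f i = f j → (f i).1 < 0 → j < i)

def DAG.IsSource {n : ℕ} (D : DAG n) (v : Fin n) : Prop := ∀ u, ¬ D.Adj u v

def DAG.IsSink {n : ℕ} (D : DAG n) (v : Fin n) : Prop := ∀ u, ¬ D.Adj v u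

/-- `D'` is obtained from `D` by a flip: all arrows at some source or sink `v` are reversed. -/
def DAG.IsFlip {n : ℕ} (D D' : DAG n) : Prop :=
  ∃ v, (D.IsSource v ∨ D.IsSink v) ∧
    ∀ i j, D'.Adj i j ↔ if i = v ∨ j = v then D.Adj j i else D.Adj i j

/-- The toric DAG `[D]`: all the DAGs which are obtained from `D` by a sequence of flips. -/
def DAG.toric {n : ℕ} (D : DAG n) : Set (DAG n) :=
  {D' | Relation.ReflTransGen DAG.IsFlip D D'}

/-- The enriched toric `[D]`-partitions: the functions which are enriched `D'`-partitions for at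
least one `D'` in `[D]`. -/
def toricPartitions {n : ℕ} (D : DAG n) : Set (Fin n → NonzeroInt) :=
  {f | ∃ D' ∈ D.toric, IsEnrichedPartition D' f}

/-- The exponent of the monomial `∏ i, x_{|f i|}`. -/
noncomputable def weight {n : ℕ} (f : Fin n → NonzeroInt) : ℕ+ →₀ ℕ :=
  ∑ i, Finsupp.single (f i).abs 1

/-- Only finitely many functions have a given weight, so that the weight enumerator below is a
well-defined formal power series. -/
lemma finite_weight_eq {n : ℕ} (m : ℕ+ →₀ ℕ) :
    {f : Fin n → NonzeroInt | weight f = m}.Finite := by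
  have hfin : {z : NonzeroInt | z.abs ∈ m.support}.Finite := by
    refine Set.Finite.preimage' m.support.finite_toSet fun b _ => ?_
    refine Set.Finite.of_finite_image (f := Subtype.val) ?_ Subtype.val_injective.injOn
    refine (Set.finite_Icc (-(b : ℤ)) b).subset ?_
    rintro _ ⟨z, hz, rfl⟩
    have : z.1.natAbs = (b : ℕ) := congrArg PNat.val hz
    rw [Set.mem_Icc]
    omega
  refine (Set.Finite.pi' fun _ : Fin n => hfin).subset ?_
  intro f hf i
  have hf : weight f = m := hf
  subst hf
  simp only [Set.mem_ofPred_eq, Finsupp.mem_support_iff, weight, Finsupp.finsetSum_apply]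
  intro h
  have := (Finset.sum_eq_zero_iff.mp h) i (Finset.mem_univ i)
  simp at this

/-- The weight enumerator `∑_f ∏ i, x_{|f i|}` of enriched toric `[D]`-partitions: the coefficient
of a monomial is the number of enriched toric `[D]`-partitions with that weight. -/
noncomputable def toricEnumerator {n : ℕ} (D : DAG n) : Series :=
  fun m => (({f | f ∈ toricPartitions D ∧ weight f = m} : Set (Fin n → NonzeroInt)).ncard : ℚ)

/-! ### Cyclic peaks -/

/-- The total linear order of the permutation `w = w₁ w₂ ⋯ wₙ`: there is an arrow `w_i → w_j`
whenever `i < j`. Its toric class is the total cyclic order `[w]`. -/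
def linearDAG {n : ℕ} (w : Equiv.Perm (Fin n)) : DAG n where
  Adj a b := w.symm a < w.symm b
  acyclic v h := by
    have key : ∀ b, Relation.TransGen (fun a b => w.symm a < w.symm b) v b →
        w.symm v < w.symm b := by
      intro b hb
      induction hb with
      | single h => exact h
      | tail _ h ih => exact ih.trans h
    exact lt_irrefl _ (key v h)

/-- The cyclic peak set `{i | w_{i-1} < w_i > w_{i+1}}`, with subscripts modulo `n`. -/
def cPk {n : ℕ} (w : Equiv.Perm (Fin n)) : Set (Fin n) :=
  {i | w ((finRotate n).symm i) < w i ∧ w (finRotate n i) < w i}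

/-- `S` is a cyclic peak set in `[n]`. -/
def IsCyclicPeakSet {n : ℕ} (S : Set (Fin n)) : Prop := ∃ w : Equiv.Perm (Fin n), cPk w = S

open Classical in
/-- `K^cyc_S`, the weight enumerator of enriched toric `[w]`-partitions for any permutation `w`
with `cPk w = S`. -/
noncomputable def KCyc {n : ℕ} (S : Set (Fin n)) : Series :=
  if h : IsCyclicPeakSet S then toricEnumerator (linearDAG h.choose) else 0

/-- `Λ_n`, the space spanned by the `K^cyc_S` with `S` a cyclic peak set in `[n]`. -/
noncomputable def peakSpaceDeg (n : ℕ) : Submodule ℚ Series :=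
  Submodule.span ℚ {K | ∃ S : Set (Fin n), IsCyclicPeakSet S ∧ K = KCyc S}

/-- `Λ`, the sum of all the `Λ_n`. -/
noncomputable def peakSpace : Submodule ℚ Series := ⨆ n, peakSpaceDeg n

end CyclicPeak

/-! Reading the vertices in increasing order of `key f` gives a permutation `std f`, and `f` is an
enriched partition of the total order `w` exactly when `std f = w`. Flipping the first or last
letter of a total order moves it to the other end, so the toric class of `w` consists of the
rotations of `w`. Hence `f` is a toric `[w]`-partition iff `std f` lies in the coset of `w` modulo
`rotations n` (`mem_toricPartitions_linearDAG`).

Two functions have `std` in the same coset iff their keys are related by cutting off a lower set and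
putting it on top (`CycRel`, `cycRel_iff`). This relation survives restriction to a subset of
vertices, so a product of two toric enumerators counts functions on `[m+n]` whose defining condition
is constant on cosets; it is therefore a sum of enumerators over a rotation-stable set, which lies
in the span (`toricEnumerator_mul_mem_span`). Sending the smallest absolute value to the largest is
another such cut, which gives cyclic quasi-symmetry.

Independence of the choice of `w` is a count of signs. Fix weakly increasing absolute values along
`w`. Each adjacency inside a block of equal values fixes exactly one sign: an ascent makes its right
end positive, a descent its left end negative. Two demands conflict precisely at a peak interior to
a block; otherwise the number of sign choices depends only on the block sizes
(`prod_card_signChoices`). So only `cPk w` matters. -/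

namespace CyclicPeak

/-! ### Sorting permutations -/

/-- A key for sorting the vertices: by absolute value of `f`, negative values first; ties are
broken decreasingly for negative values and increasingly for positive values. -/
def key {n : ℕ} (f : Fin n → NonzeroInt) (v : Fin n) : ℕ+ ×ₗ ℤ :=
  -- The shift by `-1` makes the second coordinate negative exactly when `f v` is.
  toLex ((f v).abs, if 0 < (f v).1 then (v : ℤ) else -(v : ℤ) - 1)

lemma key_lt_iff {n : ℕ} {f : Fin n → NonzeroInt} {u v : Fin n} :
    key f u < key f v ↔ (f u).abs < (f v).abs ∨ (f u).abs = (f v).abs ∧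
      (if 0 < (f u).1 then (u : ℤ) else -(u : ℤ) - 1) <
        (if 0 < (f v).1 then (v : ℤ) else -(v : ℤ) - 1) :=
  Prod.Lex.toLex_lt_toLex

lemma key_injective {n : ℕ} (f : Fin n → NonzeroInt) : Function.Injective (key f) := by
  intro u v h
  have h2 := congrArg (fun x => (ofLex x).2) h
  simp only [key, ofLex_toLex] at h2
  ext
  split_ifs at h2 <;> omega

/-- The permutation sorting the vertices by `key f`. -/
def std {n : ℕ} (f : Fin n → NonzeroInt) : Equiv.Perm (Fin n) := Tuple.sort (key f)

lemma strictMono_key_std {n : ℕ} (f : Fin n → NonzeroInt) : StrictMono (key f ∘ std f) :=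
  (Tuple.monotone_sort (key f)).strictMono_of_injective
    ((key_injective f).comp (std f).injective)

lemma perm_unique_of_strictMono {n : ℕ} {α : Type*} [LinearOrder α] {K : Fin n → α}
    {w w' : Equiv.Perm (Fin n)} (h : StrictMono (K ∘ w)) (h' : StrictMono (K ∘ w')) :
    w = w' := by
  have hK : Function.Injective K := by
    have := h.injective.comp w.symm.injective
    simpa [Function.comp_def] using this
  have := Tuple.unique_monotone h.monotone h'.monotone
  ext i
  rw [hK (congrFun this i)]

lemma strictMono_key_iff {n : ℕ} {f : Fin n → NonzeroInt} {w : Equiv.Perm (Fin n)} :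
    StrictMono (key f ∘ w) ↔ std f = w :=
  ⟨fun h => perm_unique_of_strictMono (strictMono_key_std f) h,
    fun h => h ▸ strictMono_key_std f⟩

/-- For distinct vertices, the three conditions on an arrow amount to a strict inequality of keys;
the keys are distinct, so only one permutation sorts them. -/
lemma isEnrichedPartition_linearDAG {n : ℕ} {f : Fin n → NonzeroInt}
    {w : Equiv.Perm (Fin n)} : IsEnrichedPartition (linearDAG w) f ↔ std f = w := by
  have hkey : ∀ i j : Fin n, i ≠ j → (((f i).PrecEq (f j) ∧ (f i = f j → 0 < (f i).1 → i < j) ∧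
      (f i = f j → (f i).1 < 0 → j < i)) ↔ key f i < key f j) := by
    intro i j hij
    have hij' : (i : ℕ) ≠ j := fun h => hij (Fin.ext h)
    have hi := (f i).2
    have hj := (f j).2
    have e : f i = f j ↔ (f i).1 = (f j).1 := Subtype.ext_iff
    have a1 : (f i).abs < (f j).abs ↔ (f i).1.natAbs < (f j).1.natAbs := Iff.rfl
    have a2 : (f i).abs = (f j).abs ↔ (f i).1.natAbs = (f j).1.natAbs :=
      ⟨congrArg PNat.val, fun h => PNat.eq h⟩
    rw [key_lt_iff, NonzeroInt.PrecEq, e, a1, a2, Fin.lt_def, Fin.lt_def]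
    split_ifs <;> omega
  rw [← strictMono_key_iff]
  constructor
  · intro h p q hpq
    have hpq' : w p ≠ w q := w.injective.ne hpq.ne
    exact (hkey _ _ hpq').1 (h (w p) (w q) (by simpa [linearDAG] using hpq))
  · intro h i j hij
    have hij' : w.symm i < w.symm j := hij
    have hne : i ≠ j := by rintro rfl; exact lt_irrefl _ hij'
    exact (hkey _ _ hne).2 (by simpa using h hij')

/-! ### Rotations -/

lemma finRotate_pow_val {n : ℕ} (k : ℕ) (p : Fin n) :
    (((finRotate n) ^ k) p : Fin n).val = (p + k) % n := by
  obtain _ | n := n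
  · exact p.elim0
  induction k with
  | zero => simp [Nat.mod_eq_of_lt p.2]
  | succ k ih =>
    rw [pow_succ', Equiv.Perm.mul_apply, finRotate_apply, Fin.val_add, ih]
    simp [← add_assoc]

/-- The group of rotations of the positions. -/
def rotations (n : ℕ) : Subgroup (Equiv.Perm (Fin n)) := Subgroup.zpowers (finRotate n)

lemma mem_rotations {n : ℕ} {g : Equiv.Perm (Fin n)} :
    g ∈ rotations n ↔ ∃ k : ℕ, finRotate n ^ k = g :=
  mem_zpowers_iff_mem_range_orderOf.trans (by
    simp only [Finset.mem_image, Finset.mem_range]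
    exact ⟨fun ⟨k, _, h⟩ => ⟨k, h⟩, fun ⟨k, h⟩ => ⟨k % orderOf (finRotate n),
      Nat.mod_lt _ (orderOf_pos _), by rw [pow_mod_orderOf, h]⟩⟩)

/-- `K` and `K'` order `V` in the same way, except that the lower set `U` for `K` is moved to the
top for `K'`. -/
def CycRel {V α β : Type*} [LT α] [LT β] (K : V → α) (K' : V → β) : Prop :=
  ∃ U : Set V, (∀ u v, (u ∈ U ↔ v ∈ U) → (K u < K v ↔ K' u < K' v)) ∧
    ∀ u ∈ U, ∀ v ∉ U, K u < K v ∧ K' v < K' u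

lemma CycRel.comp {V W α β : Type*} [LT α] [LT β] {K : V → α} {K' : V → β}
    (h : CycRel K K') (e : W → V) : CycRel (K ∘ e) (K' ∘ e) := by
  obtain ⟨U, h1, h2⟩ := h
  exact ⟨e ⁻¹' U, fun u v => h1 (e u) (e v), fun u hu v hv => h2 (e u) hu (e v) hv⟩

lemma cycRel_congr {V α β γ δ : Type*} [LT α] [LT β] [LT γ] [LT δ] {K : V → α} {K' : V → β}
    {L : V → γ} {L' : V → δ} (h : ∀ u v, K u < K v ↔ L u < L v)
    (h' : ∀ u v, K' u < K' v ↔ L' u < L' v) : CycRel K K' ↔ CycRel L L' := by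
  simp only [CycRel, h, h']

/-- The lower set of a cut occupies the first `r` positions of `w`, and moving it to the top is
rotation by `r`. -/
lemma cycRel_iff {n : ℕ} {α β : Type*} [LinearOrder α] [LinearOrder β] {K : Fin n → α}
    {K' : Fin n → β} {w w' : Equiv.Perm (Fin n)} (h : StrictMono (K ∘ w))
    (h' : StrictMono (K' ∘ w')) : CycRel K K' ↔ w⁻¹ * w' ∈ rotations n := by
  rw [mem_rotations]
  constructor
  · rintro ⟨U, h1, h2⟩
    -- The least bound on the positions of `U` is its size: since `U` lies below its complement, no
    -- position under this bound can be missing.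
    have hex : ∃ r : ℕ, ∀ p : Fin n, w p ∈ U → p.val < r := ⟨n, fun p _ => p.2⟩
    classical
    have hr := Nat.find_spec hex
    have hrn : Nat.find hex ≤ n := Nat.find_min' hex fun p _ => p.2
    have hU : ∀ p : Fin n, w p ∈ U ↔ p.val < Nat.find hex := by
      refine fun p => ⟨hr p, fun hp => ?_⟩
      by_contra hpU
      have := Nat.find_min hex (m := Nat.find hex - 1) (by omega)
      push Not at this
      obtain ⟨q, hqU, hq⟩ := this
      have hpq : p ≤ q := by rw [Fin.le_def]; omega
      exact absurd ((h2 _ hqU _ hpU).1) (not_lt.2 (h.monotone hpq))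
    generalize Nat.find hex = r at hU hrn
    refine ⟨r, ?_⟩
    rw [eq_inv_mul_iff_mul_eq]
    refine perm_unique_of_strictMono (K := K') ?_ h'
    intro p q hpq
    have hp := finRotate_pow_val r p
    have hq := finRotate_pow_val r q
    have hpn := p.2
    have hqn := q.2
    rw [Fin.lt_def] at hpq
    simp only [Function.comp, Equiv.Perm.mul_apply]
    generalize (finRotate n ^ r) p = p' at hp ⊢
    generalize (finRotate n ^ r) q = q' at hq ⊢
    have hm : ∀ x : ℕ, x < n → (x + r) % n = if x + r < n then x + r else x + r - n := by
      intro x hx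
      split_ifs with hxr
      · exact Nat.mod_eq_of_lt hxr
      · rw [Nat.mod_eq_sub_mod (by omega), Nat.mod_eq_of_lt (by omega)]
    rw [hm _ hpn] at hp
    rw [hm _ hqn] at hq
    have hpU := hU p'
    have hqU := hU q'
    by_cases hc : (w p' ∈ U ↔ w q' ∈ U)
    · refine (h1 _ _ hc).1 (h ?_)
      rw [hpU, hqU] at hc
      rw [Fin.lt_def]
      split_ifs at hp hq <;> omega
    · refine (h2 _ ?_ _ ?_).2
      · rw [hqU]
        rw [hpU, hqU] at hc
        split_ifs at hp hq <;> omega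
      · rw [hpU]
        rw [hpU, hqU] at hc
        split_ifs at hp hq <;> omega
  · rintro ⟨k, hk⟩
    rw [eq_inv_mul_iff_mul_eq] at hk
    subst hk
    have key1 : ∀ u v, K u < K v ↔ w.symm u < w.symm v := fun u v => by
      rw [← h.lt_iff_lt]; simp
    have key2 : ∀ u v, K' u < K' v ↔
        (w * finRotate n ^ k).symm u < (w * finRotate n ^ k).symm v := fun u v => by
      rw [← h'.lt_iff_lt]
      simp only [Function.comp, Equiv.apply_symm_apply]
    rw [cycRel_congr key1 key2]
    -- The first `k % n` letters of `w` are those that the rotation carries past the end.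
    refine ⟨{v | (w.symm v).val < k % n}, ?_⟩
    have hv : ∀ v : Fin n, (w.symm v).val =
        if ((w * finRotate n ^ k).symm v).val + k % n < n
        then ((w * finRotate n ^ k).symm v).val + k % n
        else ((w * finRotate n ^ k).symm v).val + k % n - n := by
      intro v
      have hn : 0 < n := v.pos
      have e : w.symm v = (finRotate n ^ k) ((w * finRotate n ^ k).symm v) := by
        rw [Equiv.symm_apply_eq, ← Equiv.Perm.mul_apply, Equiv.apply_symm_apply]
      have hlt := ((w * finRotate n ^ k).symm v).2
      rw [e, finRotate_pow_val]
      generalize ((w * finRotate n ^ k).symm v).val = x at hlt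
      have := Nat.mod_lt k hn
      rw [Nat.add_mod, Nat.mod_eq_of_lt hlt]
      split_ifs with hxr
      · exact Nat.mod_eq_of_lt hxr
      · rw [Nat.mod_eq_sub_mod (by omega), Nat.mod_eq_of_lt (by omega)]
    simp only [Set.mem_ofPred_eq, Fin.lt_def]
    refine ⟨fun u v huv => ?_, fun u hu v hv' => ?_⟩
    · have := hv u
      have := hv v
      have := ((w * finRotate n ^ k).symm u).2
      have := ((w * finRotate n ^ k).symm v).2
      have := Nat.mod_lt k u.pos
      split_ifs at * <;> omega
    · have := hv u
      have := hv v
      have := ((w * finRotate n ^ k).symm u).2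
      have := ((w * finRotate n ^ k).symm v).2
      have := Nat.mod_lt k u.pos
      split_ifs at * <;> omega

/-! ### Toric classes of total orders -/

lemma DAG.ext_adj {n : ℕ} {D D' : DAG n} (h : ∀ i j, D.Adj i j ↔ D'.Adj i j) : D = D' := by
  obtain ⟨⟨A⟩, _⟩ := D
  obtain ⟨⟨A'⟩, _⟩ := D'
  obtain rfl : A = A' := by
    ext i j
    exact h i j
  rfl

lemma adj_linearDAG_mul {n : ℕ} (w : Equiv.Perm (Fin n)) (i j : Fin n) :
    (linearDAG (w * finRotate n)).Adj i j ↔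
      (finRotate n).symm (w.symm i) < (finRotate n).symm (w.symm j) := Iff.rfl

lemma lt_iff_finRotate_lt_zero {n : ℕ} (p q : Fin (n + 1)) :
    p < q ↔ if finRotate (n + 1) p = 0 ∨ finRotate (n + 1) q = 0
      then finRotate (n + 1) q < finRotate (n + 1) p
      else finRotate (n + 1) p < finRotate (n + 1) q := by
  have := p.2
  have := q.2
  have hp := coe_finRotate p
  have hq := coe_finRotate q
  simp only [Nat.succ_eq_add_one, Fin.ext_iff, Fin.lt_def, Fin.val_last, Fin.val_zero] at hp hq ⊢
  split_ifs at hp hq ⊢ <;> omega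

lemma finRotate_lt_iff_lt_last {n : ℕ} (p q : Fin (n + 1)) :
    finRotate (n + 1) p < finRotate (n + 1) q ↔ if p = Fin.last n ∨ q = Fin.last n
      then q < p else p < q := by
  have := p.2
  have := q.2
  simp only [Fin.ext_iff, Fin.lt_def, coe_finRotate, Fin.val_last]
  split_ifs <;> omega

/-- The only source is the first letter and the only sink the last; flipping them multiplies `w` on
the right by `finRotate n` or its inverse. Every rotation is a natural power of `finRotate n`, so
source flips alone reach the whole coset. -/
lemma mem_toric_linearDAG {n : ℕ} {w : Equiv.Perm (Fin n)} {D : DAG n} :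
    D ∈ (linearDAG w).toric ↔ ∃ g ∈ rotations n, D = linearDAG (w * g) := by
  constructor
  · intro h
    change Relation.ReflTransGen DAG.IsFlip (linearDAG w) D at h
    induction h with
    | refl => exact ⟨1, one_mem _, by rw [mul_one]⟩
    | @tail D D' _ hf ih =>
      obtain ⟨g, hg, rfl⟩ := ih
      generalize hw : w * g = w' at hf
      obtain ⟨v, hv, hadj⟩ := hf
      obtain _ | n := n
      · exact v.elim0
      have hadj' : ∀ i j, D'.Adj i j ↔ if w'.symm i = w'.symm v ∨ w'.symm j = w'.symm v
          then w'.symm j < w'.symm i else w'.symm i < w'.symm j := by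
        intro i j
        simp only [Equiv.apply_eq_iff_eq]
        exact hadj i j
      rcases hv with hv | hv
      · refine ⟨g * finRotate _, mul_mem hg (Subgroup.mem_zpowers _), ?_⟩
        have h0 : w'.symm v = 0 := by
          have : ¬ w'.symm (w' 0) < w'.symm v := hv (w' 0)
          simpa using this
        refine DAG.ext_adj fun i j => ?_
        rw [← mul_assoc, hw, adj_linearDAG_mul, lt_iff_finRotate_lt_zero, hadj' i j, h0]
        simp only [Equiv.apply_symm_apply]
      · refine ⟨g * (finRotate _)⁻¹, mul_mem hg (inv_mem (Subgroup.mem_zpowers _)), ?_⟩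
        have h0 : w'.symm v = Fin.last n := by
          have : ¬ w'.symm v < w'.symm (w' (Fin.last n)) := hv (w' (Fin.last n))
          rw [Equiv.symm_apply_apply, not_lt] at this
          exact le_antisymm (Fin.le_last _) this
        refine DAG.ext_adj fun i j => ?_
        rw [← mul_assoc, hw, hadj' i j, h0, ← finRotate_lt_iff_lt_last]
        exact Iff.rfl
  · rintro ⟨g, hg, rfl⟩
    obtain ⟨k, rfl⟩ := mem_rotations.1 hg
    clear hg
    change Relation.ReflTransGen _ _ _
    induction k with
    | zero => rw [pow_zero, mul_one]
    | succ k ih =>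
      refine ih.trans ?_
      generalize hw : w * finRotate n ^ k = w'
      rw [pow_succ, ← mul_assoc, hw]
      obtain _ | n := n
      · rw [Subsingleton.elim (w' * finRotate 0) w']
      refine .single ⟨w' 0, Or.inl fun u hu => ?_, fun i j => ?_⟩
      · have hu : w'.symm u < w'.symm (w' 0) := hu
        rw [Equiv.symm_apply_apply] at hu
        exact absurd hu (Fin.not_lt_zero _)
      · rw [adj_linearDAG_mul, lt_iff_finRotate_lt_zero]
        simp only [Equiv.apply_symm_apply, Equiv.symm_apply_eq]
        exact Iff.rfl

lemma mem_toricPartitions_linearDAG {n : ℕ} {w : Equiv.Perm (Fin n)} {f : Fin n → NonzeroInt} :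
    f ∈ toricPartitions (linearDAG w) ↔ w⁻¹ * std f ∈ rotations n := by
  constructor
  · rintro ⟨D, hD, hf⟩
    obtain ⟨g, hg, rfl⟩ := mem_toric_linearDAG.1 hD
    rw [isEnrichedPartition_linearDAG.1 hf, inv_mul_cancel_left]
    exact hg
  · intro h
    refine ⟨linearDAG (std f), mem_toric_linearDAG.2 ⟨_, h, ?_⟩,
      isEnrichedPartition_linearDAG.2 rfl⟩
    rw [mul_inv_cancel_left]

lemma mem_toricPartitions_iff_of_cycRel {n : ℕ} {w : Equiv.Perm (Fin n)}
    {f f' : Fin n → NonzeroInt} (h : CycRel (key f) (key f')) :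
    f ∈ toricPartitions (linearDAG w) ↔ f' ∈ toricPartitions (linearDAG w) := by
  rw [cycRel_iff (strictMono_key_std f) (strictMono_key_std f')] at h
  rw [mem_toricPartitions_linearDAG, mem_toricPartitions_linearDAG,
    ← Subgroup.mul_mem_cancel_right _ h, mul_assoc, mul_inv_cancel_left]

/-! ### Weight enumerators -/

/-- The weight enumerator of a set of functions. -/
noncomputable def enumerator {n : ℕ} (A : Set (Fin n → NonzeroInt)) : Series :=
  fun m => (({f | f ∈ A ∧ weight f = m} : Set (Fin n → NonzeroInt)).ncard : ℚ)

lemma toricEnumerator_eq_enumerator {n : ℕ} (D : DAG n) :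
    toricEnumerator D = enumerator (toricPartitions D) := rfl

open Classical in
lemma coeff_enumerator {n : ℕ} (A : Set (Fin n → NonzeroInt)) (M : ℕ+ →₀ ℕ) :
    MvPowerSeries.coeff M (enumerator A) =
      (((finite_weight_eq M).toFinset.filter (· ∈ A)).card : ℚ) := by
  change (Set.ncard _ : ℚ) = _
  rw [← Set.ncard_coe_finset]
  congr 2
  ext f
  simp [and_comm]

lemma enumerator_preimage_finset {n : ℕ} {ι : Type*} (φ : (Fin n → NonzeroInt) → ι)
    (T : Finset ι) : enumerator {f | φ f ∈ T} = ∑ w ∈ T, enumerator {f | φ f = w} := by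
  classical
  ext M
  simp only [map_sum, coeff_enumerator]
  norm_cast
  rw [Finset.card_eq_sum_card_fiberwise (f := φ) (t := T)]
  · refine Finset.sum_congr rfl fun w hw => congrArg _ ?_
    ext f
    simp only [Finset.mem_filter, Set.mem_ofPred_eq]
    exact ⟨fun h => ⟨h.1.1, h.2⟩, fun h => ⟨⟨h.1, h.2 ▸ hw⟩, h.2⟩⟩
  · intro f hf
    simp only [Finset.coe_filter, Set.mem_ofPred_eq] at hf
    exact hf.2

lemma weight_add {m n : ℕ} (f : Fin (m + n) → NonzeroInt) :
    weight f = weight (f ∘ Fin.castAdd n) + weight (f ∘ Fin.natAdd m) := by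
  simp [weight, Fin.sum_univ_add]

lemma enumerator_mul {m n : ℕ} (A : Set (Fin m → NonzeroInt)) (B : Set (Fin n → NonzeroInt)) :
    enumerator A * enumerator B =
      enumerator {f | f ∘ Fin.castAdd n ∈ A ∧ f ∘ Fin.natAdd m ∈ B} := by
  classical
  ext M
  rw [MvPowerSeries.coeff_mul]
  simp only [coeff_enumerator]
  norm_cast
  rw [Finset.card_eq_sum_card_fiberwise
    (f := fun f => (weight (f ∘ Fin.castAdd n), weight (f ∘ Fin.natAdd m)))
    (t := Finset.HasAntidiagonal.antidiagonal M)]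
  · refine Finset.sum_congr rfl fun p hp => ?_
    rw [← Finset.card_product]
    refine Finset.card_equiv (Fin.appendEquiv m n) ?_
    rintro ⟨f, g⟩
    rw [Finset.HasAntidiagonal.mem_antidiagonal] at hp
    have h1 : (Fin.append f g) ∘ Fin.castAdd n = f := by ext; simp
    have h2 : (Fin.append f g) ∘ Fin.natAdd m = g := by ext; simp
    simp only [Fin.appendEquiv, Equiv.coe_fn_mk, Finset.mem_product, Finset.mem_filter,
      Set.Finite.mem_toFinset, Set.mem_ofPred_eq, weight_add, h1, h2, Prod.ext_iff]
    constructor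
    · rintro ⟨⟨h, ha⟩, h', hb⟩
      exact ⟨⟨by rw [h, h', hp], ha, hb⟩, h, h'⟩
    · rintro ⟨⟨_, ha, hb⟩, h, h'⟩
      exact ⟨⟨h, ha⟩, h', hb⟩
  · intro f hf
    simp only [Finset.coe_filter, Set.mem_ofPred_eq, Set.Finite.mem_toFinset] at hf
    simp only [Finset.mem_coe, Finset.HasAntidiagonal.mem_antidiagonal, ← weight_add, hf.1]

open Classical in
lemma toricEnumerator_linearDAG {n : ℕ} (w : Equiv.Perm (Fin n)) :
    toricEnumerator (linearDAG w) =
      ∑ g with g ∈ rotations n, enumerator {f | std f = w * g} := by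
  have : toricPartitions (linearDAG w) =
      {f | w⁻¹ * std f ∈ Finset.univ.filter (· ∈ rotations n)} := by
    ext f
    simp [mem_toricPartitions_linearDAG]
  rw [toricEnumerator_eq_enumerator, this, enumerator_preimage_finset fun f => w⁻¹ * std f]
  simp only [inv_mul_eq_iff_eq_mul]

/-- Averaging argument: right translation by each rotation permutes `T`, so summing the toric
enumerators over `T` counts every fibre once per rotation. -/
lemma sum_enumerator_mem_span {n : ℕ} (T : Finset (Equiv.Perm (Fin n)))
    (hT : ∀ w, ∀ g ∈ rotations n, (w * g ∈ T ↔ w ∈ T)) :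
    ∑ w ∈ T, enumerator {f | std f = w} ∈
      Submodule.span ℚ (Set.range fun w : Equiv.Perm (Fin n) =>
        toricEnumerator (linearDAG w)) := by
  classical
  have h : ∑ w ∈ T, toricEnumerator (linearDAG w) =
      ((Finset.univ.filter (· ∈ rotations n)).card : ℚ) •
        ∑ w ∈ T, enumerator {f | std f = w} := by
    simp only [toricEnumerator_linearDAG]
    rw [Finset.sum_comm, Finset.sum_congr rfl (g := fun _ =>
      ∑ w ∈ T, enumerator {f | std f = w}), Finset.sum_const, Nat.cast_smul_eq_nsmul]
    intro g hg
    refine Finset.sum_equiv (Equiv.mulRight g) (fun w => ?_) fun w _ => rfl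
    exact (hT w g (by simpa using hg)).symm
  have hne : ((Finset.univ.filter (· ∈ rotations n)).card : ℚ) ≠ 0 := by
    rw [Nat.cast_ne_zero, Finset.card_ne_zero]
    exact ⟨1, by simp⟩
  rw [← Submodule.smul_mem_iff _ hne, ← h]
  exact Submodule.sum_mem _ fun w _ => Submodule.subset_span ⟨w, rfl⟩

/-! ### Products -/

lemma key_comp_lt_iff {m n : ℕ} {e : Fin m → Fin n} (he : StrictMono e)
    (f : Fin n → NonzeroInt) (u v : Fin m) :
    (key f ∘ e) u < (key f ∘ e) v ↔ key (f ∘ e) u < key (f ∘ e) v := by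
  have h1 : (e u : ℕ) < e v ↔ (u : ℕ) < v := he.lt_iff_lt
  have h2 : (e v : ℕ) < e u ↔ (v : ℕ) < u := he.lt_iff_lt
  simp only [Function.comp, key_lt_iff]
  refine or_congr Iff.rfl (and_congr_right fun _ => ?_)
  split_ifs <;> omega

/-- A cut of the vertices restricts to a cut of any subset, and an increasing `e` does not disturb
the tie-breaking by labels. -/
lemma comp_mem_toricPartitions_iff {m n : ℕ} {e : Fin m → Fin n} (he : StrictMono e)
    {f f' : Fin n → NonzeroInt} (h : (std f)⁻¹ * std f' ∈ rotations n)
    (w : Equiv.Perm (Fin m)) :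
    f ∘ e ∈ toricPartitions (linearDAG w) ↔ f' ∘ e ∈ toricPartitions (linearDAG w) := by
  rw [← cycRel_iff (strictMono_key_std f) (strictMono_key_std f')] at h
  exact mem_toricPartitions_iff_of_cycRel
    ((cycRel_congr (key_comp_lt_iff he f) (key_comp_lt_iff he f')).1 (h.comp e))

lemma std_surjective (n : ℕ) : Function.Surjective (std (n := n)) := by
  intro w
  refine ⟨fun v => ⟨(w.symm v : ℤ) + 1, by omega⟩, strictMono_key_iff.1 fun p q hpq => ?_⟩
  simp only [Function.comp, key_lt_iff]
  left
  rw [← PNat.coe_lt_coe]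
  simp only [NonzeroInt.abs, Equiv.symm_apply_apply, PNat.mk_coe]
  omega

lemma toricEnumerator_mul_mem_span {m n : ℕ} (u : Equiv.Perm (Fin m))
    (v : Equiv.Perm (Fin n)) :
    toricEnumerator (linearDAG u) * toricEnumerator (linearDAG v) ∈
      Submodule.span ℚ (Set.range fun w : Equiv.Perm (Fin (m + n)) =>
        toricEnumerator (linearDAG w)) := by
  classical
  let P : Set (Fin (m + n) → NonzeroInt) :=
    {f | f ∘ Fin.castAdd n ∈ toricPartitions (linearDAG u) ∧
    f ∘ Fin.natAdd m ∈ toricPartitions (linearDAG v)}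
  have hP : ∀ f f', (std f)⁻¹ * std f' ∈ rotations (m + n) → (f ∈ P ↔ f' ∈ P) :=
    fun f f' h => and_congr
      (comp_mem_toricPartitions_iff (Fin.strictMono_castAdd n) h u)
      (comp_mem_toricPartitions_iff (Fin.strictMono_natAdd m) h v)
  -- Since `P` is constant on cosets, it can be tested on one representative `s w` of each fibre of
  -- `std`.
  let s := Function.surjInv (std_surjective (m + n))
  have hs : ∀ w, std (s w) = w := Function.surjInv_eq (std_surjective (m + n))
  let T : Finset (Equiv.Perm (Fin (m + n))) := Finset.univ.filter fun w => s w ∈ P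
  have hPT : P = {f | std f ∈ T} := by
    ext f
    simp only [T, Set.mem_ofPred_eq, Finset.mem_filter, Finset.mem_univ, true_and]
    exact hP _ _ (by rw [hs, inv_mul_cancel]; exact one_mem _)
  rw [toricEnumerator_eq_enumerator, toricEnumerator_eq_enumerator, enumerator_mul]
  change enumerator P ∈ _
  rw [hPT, enumerator_preimage_finset]
  refine sum_enumerator_mem_span T fun w g hg => ?_
  simp only [T, Finset.mem_filter, Finset.mem_univ, true_and]
  exact (hP _ _ (by rw [hs, hs, inv_mul_cancel_left]; exact hg)).symm

/-! ### Cyclic quasi-symmetry -/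

lemma NonzeroInt.ext_abs {y z : NonzeroInt} (h : y.abs = z.abs) (h' : 0 < y.1 ↔ 0 < z.1) :
    y = z := by
  have h : y.1.natAbs = z.1.natAbs := congrArg PNat.val h
  have := y.2
  have := z.2
  ext
  omega

/-- The nonzero integer with the given sign and absolute value. -/
def signed (b : Bool) (k : ℕ+) : NonzeroInt :=
  ⟨if b then (k : ℤ) else -(k : ℤ), by have := k.pos; split_ifs <;> omega⟩

@[simp]
lemma abs_signed (b : Bool) (k : ℕ+) : (signed b k).abs = k := by
  apply PNat.eq
  simp only [signed, NonzeroInt.abs, PNat.mk_coe]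
  split_ifs <;> omega

@[simp]
lemma signed_pos_iff (b : Bool) (k : ℕ+) : 0 < (signed b k).1 ↔ b = true := by
  have := k.pos
  simp only [signed]
  split_ifs with h <;> simp [h]

/-- Change the absolute value by `τ`, keeping the sign. -/
def relabel (τ : ℕ+ → ℕ+) (z : NonzeroInt) : NonzeroInt := signed (decide (0 < z.1)) (τ z.abs)

lemma weight_relabel {n : ℕ} (τ : ℕ+ → ℕ+) (f : Fin n → NonzeroInt) :
    weight (relabel τ ∘ f) = (weight f).mapDomain τ := by
  simp [weight, relabel, Finsupp.mapDomain_finsetSum, Finsupp.mapDomain_single]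

lemma abs_mem_range {n s : ℕ} {f : Fin n → NonzeroInt} {i : Fin s → ℕ+} {a : Fin s → ℕ}
    (h : weight f = expo i a) (v : Fin n) : ∃ k, i k = (f v).abs := by
  by_contra hv
  push Not at hv
  have h1 : weight f (f v).abs = 0 := by
    rw [h, expo, Finsupp.finsetSum_apply]
    exact Finset.sum_eq_zero fun k _ => Finsupp.single_eq_of_ne (hv k).symm
  rw [weight, Finsupp.finsetSum_apply, Finset.sum_eq_zero_iff] at h1
  have := h1 v (Finset.mem_univ v)
  simp at this

lemma finRotate_symm_lt_iff {t : ℕ} (k l : Fin (t + 1)) (h : k = 0 ↔ l = 0) :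
    (finRotate (t + 1)).symm k < (finRotate (t + 1)).symm l ↔ k < l := by
  rw [lt_iff_finRotate_lt_zero]
  simp only [Equiv.apply_symm_apply]
  by_cases hk : k = 0
  · simp [hk, h.1 hk]
  · simp [hk, mt h.2 hk]

lemma finRotate_symm_lt_of_ne_zero {t : ℕ} {k : Fin (t + 1)} (hk : k ≠ 0) :
    (finRotate (t + 1)).symm k < (finRotate (t + 1)).symm 0 := by
  rw [lt_iff_finRotate_lt_zero]
  simpa using Fin.pos_of_ne_zero hk

/-- The cut consists of the vertices with the smallest absolute value `i 0`, which becomes the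
largest; signs are kept, so ties are broken as before. -/
lemma cycRel_key_relabel {n t : ℕ} {f : Fin n → NonzeroInt} {i j : Fin (t + 1) → ℕ+}
    (hi : StrictMono i) (hj : StrictMono j) {τ : ℕ+ → ℕ+}
    (hτ : ∀ k, τ (i k) = j ((finRotate (t + 1)).symm k)) (hf : ∀ v, ∃ k, i k = (f v).abs) :
    CycRel (key f) (key (relabel τ ∘ f)) := by
  choose b hb using hf
  refine ⟨{v | b v = 0}, fun u v huv => ?_, fun u hu v hv => ?_⟩
  · simp only [Set.mem_ofPred_eq] at huv
    simp only [key_lt_iff, relabel, Function.comp, abs_signed, signed_pos_iff,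
      decide_eq_true_eq, ← hb, hτ, hi.lt_iff_lt, hj.lt_iff_lt, hi.injective.eq_iff,
      hj.injective.eq_iff, EmbeddingLike.apply_eq_iff_eq, finRotate_symm_lt_iff _ _ huv]
  · simp only [Set.mem_ofPred_eq] at hu hv
    simp only [key_lt_iff, relabel, Function.comp, abs_signed, ← hb, hτ, hu]
    exact ⟨Or.inl (hi (Fin.pos_of_ne_zero hv)), Or.inl (hj (finRotate_symm_lt_of_ne_zero hv))⟩

/-- Relabelling absolute values injects one set of partitions into the other. An inequality
suffices, because rotation has finite order and the inequalities close up into a cycle. -/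
lemma coeff_toricEnumerator_le_finRotate {n s : ℕ} (w : Equiv.Perm (Fin n)) (a : Fin s → ℕ)
    {i j : Fin s → ℕ+} (hi : StrictMono i) (hj : StrictMono j) :
    MvPowerSeries.coeff (expo i a) (toricEnumerator (linearDAG w)) ≤
      MvPowerSeries.coeff (expo j (a ∘ finRotate s)) (toricEnumerator (linearDAG w)) := by
  classical
  obtain _ | t := s
  · simp [expo]
  -- The default `id` is never used: every absolute value that occurs is some `i k`.
  let τ : ℕ+ → ℕ+ := Function.extend i (j ∘ (finRotate (t + 1)).symm) id
  have hτ : ∀ k, τ (i k) = j ((finRotate (t + 1)).symm k) := fun k =>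
    hi.injective.extend_apply _ _ k
  rw [toricEnumerator_eq_enumerator, coeff_enumerator, coeff_enumerator, Nat.cast_le]
  refine Finset.card_le_card_of_injOn (fun f => relabel τ ∘ f) ?_ ?_
  · intro f hf
    simp only [Finset.coe_filter, Set.Finite.mem_toFinset, Set.mem_ofPred_eq] at hf ⊢
    refine ⟨?_, (mem_toricPartitions_iff_of_cycRel
      (cycRel_key_relabel hi hj hτ (abs_mem_range hf.1))).1 hf.2⟩
    rw [weight_relabel, hf.1, expo_comp_perm]
    simp [expo, Finsupp.mapDomain_finsetSum, Finsupp.mapDomain_single, hτ]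
  · intro f hf f' hf' h
    simp only [Finset.coe_filter, Set.Finite.mem_toFinset, Set.mem_ofPred_eq] at hf hf'
    funext v
    obtain ⟨k, hk⟩ := abs_mem_range hf.1 v
    obtain ⟨k', hk'⟩ := abs_mem_range hf'.1 v
    have hv : relabel τ (f v) = relabel τ (f' v) := congrFun h v
    have h1 := congrArg NonzeroInt.abs hv
    have h2 : 0 < (relabel τ (f v)).1 ↔ 0 < (relabel τ (f' v)).1 := by rw [hv]
    simp only [relabel, abs_signed, signed_pos_iff, decide_eq_true_eq, ← hk, ← hk', hτ,
      hj.injective.eq_iff, EmbeddingLike.apply_eq_iff_eq] at h1 h2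
    exact NonzeroInt.ext_abs (by rw [← hk, ← hk', h1]) h2

/-- The exponent is `c + 1` because the first step is the one that passes from `i` to `j`. -/
lemma coeff_toricEnumerator_le_iterate {n s : ℕ} (w : Equiv.Perm (Fin n)) (a : Fin s → ℕ)
    (c : ℕ) {i j : Fin s → ℕ+} (hi : StrictMono i) (hj : StrictMono j) :
    MvPowerSeries.coeff (expo i a) (toricEnumerator (linearDAG w)) ≤
      MvPowerSeries.coeff (expo j (a ∘ ⇑(finRotate s ^ (c + 1))))
        (toricEnumerator (linearDAG w)) := by
  induction c generalizing j with
  | zero => simpa using coeff_toricEnumerator_le_finRotate w a hi hj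
  | succ c ih =>
    refine (ih hj).trans ((coeff_toricEnumerator_le_finRotate w _ hj hj).trans_eq ?_)
    rw [pow_succ _ (c + 1), Equiv.Perm.coe_mul]
    rfl

lemma isCyclicQuasiSymmetric_toricEnumerator {n : ℕ} (w : Equiv.Perm (Fin n)) :
    IsCyclicQuasiSymmetric (toricEnumerator (linearDAG w)) := by
  intro s a _ c i j hi hj
  have ho := pow_orderOf_eq_one (finRotate s)
  obtain ⟨d, hd⟩ : ∃ d, orderOf (finRotate s) = d + 1 :=
    ⟨_, (Nat.succ_pred_eq_of_pos (orderOf_pos (finRotate s))).symm⟩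
  rw [hd] at ho
  rw [← Equiv.Perm.coe_pow]
  refine le_antisymm ?_ ?_
  · refine (coeff_toricEnumerator_le_iterate w a (c + d) hi hj).trans_eq ?_
    rw [add_assoc, pow_add, ho, mul_one]
  -- With `d + 1` the order of the rotation, these steps bring the total to the multiple `(d + 1) *
  -- (c + 1)` of that order.
  · refine (coeff_toricEnumerator_le_iterate w _ (c * d + d) hj hi).trans_eq ?_
    rw [Function.comp_assoc, ← Equiv.Perm.coe_mul, ← pow_add,
      show c + (c * d + d + 1) = (d + 1) * (c + 1) by ring, pow_mul, ho, one_pow]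
    rfl

lemma degree_weight {n : ℕ} (f : Fin n → NonzeroInt) : (weight f).degree = n := by
  simp [weight]

lemma isHomogeneous_toricEnumerator {n : ℕ} (D : DAG n) :
    (toricEnumerator D).IsHomogeneous n := by
  classical
  intro M hM
  rw [toricEnumerator_eq_enumerator, coeff_enumerator, Nat.cast_ne_zero,
    Finset.card_ne_zero] at hM
  obtain ⟨f, hf⟩ := hM
  rw [Finset.mem_filter, Set.Finite.mem_toFinset] at hf
  rw [← hf.1]
  exact (DFunLike.congr_fun Finsupp.degree_eq_weight_one _).symm.trans (degree_weight f)

lemma iSupIndep_cQSymDeg : iSupIndep cQSymDeg := by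
  intro n
  rw [Submodule.disjoint_def]
  intro f hf hf'
  have h : (⨆ k, ⨆ (_ : k ≠ n), cQSymDeg k) ≤
      ⨅ (d : ℕ+ →₀ ℕ) (_ : d.degree = n), LinearMap.ker (MvPowerSeries.coeff (R := ℚ) d) := by
    refine iSup₂_le fun k hk => le_iInf₂ fun d hd g hg => ?_
    exact MvPowerSeries.IsHomogeneous.coeff_eq_zero hg.2 (by rw [hd]; exact hk.symm)
  ext d
  by_cases hd : d.degree = n
  · have := h hf'
    simp only [Submodule.mem_iInf, LinearMap.mem_ker] at this
    exact this d hd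
  · exact MvPowerSeries.IsHomogeneous.coeff_eq_zero hf.2 hd

/-! ### The enumerator of a total order depends only on its peaks -/

/-- There is an ascent of `w` between two adjacent positions of the same block of `h`. -/
def IsBlockAscent {n : ℕ} (h : Fin (n + 1) → ℕ+) (w : Equiv.Perm (Fin (n + 1)))
    (a : Fin n) : Prop :=
  h a.castSucc = h a.succ ∧ w a.castSucc < w a.succ

/-- There is a descent of `w` between two adjacent positions of the same block of `h`. -/
def IsBlockDescent {n : ℕ} (h : Fin (n + 1) → ℕ+) (w : Equiv.Perm (Fin (n + 1)))
    (a : Fin n) : Prop :=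
  h a.castSucc = h a.succ ∧ w a.succ < w a.castSucc

open Classical in
/-- The signs which are allowed at position `p`, given the absolute values `h`. -/
noncomputable def signChoices {n : ℕ} (h : Fin (n + 1) → ℕ+) (w : Equiv.Perm (Fin (n + 1)))
    (p : Fin (n + 1)) : Finset Bool :=
  {b | ((∃ a, a.succ = p ∧ IsBlockAscent h w a) → b = true) ∧
    ((∃ a, a.castSucc = p ∧ IsBlockDescent h w a) → b = false)}

/-- Some position is a peak of `w` in the interior of a block of `h`. -/
def HasBlockPeak {n : ℕ} (h : Fin (n + 1) → ℕ+) (w : Equiv.Perm (Fin (n + 1))) : Prop :=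
  ∃ p, (∃ a, a.succ = p ∧ IsBlockAscent h w a) ∧ ∃ a, a.castSucc = p ∧ IsBlockDescent h w a

lemma finRotate_castSucc {n : ℕ} (a : Fin n) : finRotate (n + 1) a.castSucc = a.succ := by
  ext
  rw [coe_finRotate_of_ne_last (Fin.castSucc_lt_last a).ne]
  simp

/-- A position interior to a block has neighbours on both sides, so its cyclic neighbours are its
linear ones and wrap-around plays no role. -/
lemma hasBlockPeak_iff {n : ℕ} (h : Fin (n + 1) → ℕ+) (w : Equiv.Perm (Fin (n + 1))) :
    HasBlockPeak h w ↔ ∃ p ∈ cPk w, (∃ a : Fin n, a.succ = p ∧ h a.castSucc = h a.succ) ∧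
      ∃ a : Fin n, a.castSucc = p ∧ h a.castSucc = h a.succ := by
  have hs : ∀ a : Fin n, (finRotate (n + 1)).symm a.succ = a.castSucc := fun a => by
    rw [Equiv.symm_apply_eq, finRotate_castSucc]
  constructor
  · rintro ⟨p, ⟨a, ha, ha1, ha2⟩, b, rfl, hb1, hb2⟩
    refine ⟨_, ⟨?_, ?_⟩, ⟨a, ha, ha1⟩, b, rfl, hb1⟩
    · rw [← ha, hs]
      exact ha2
    · rw [finRotate_castSucc]
      exact hb2
  · rintro ⟨p, ⟨hp1, hp2⟩, ⟨a, ha, ha1⟩, b, rfl, hb1⟩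
    refine ⟨_, ⟨a, ha, ha1, ?_⟩, b, rfl, hb1, ?_⟩
    · rwa [← ha, hs] at hp1
    · rwa [finRotate_castSucc] at hp2

-- Each demand at `p` halves the two signs, and without a block peak there is at most one. The sums
-- over `a` count these demands in a form that can later be exchanged with a sum over `p`.
open Classical in
lemma card_signChoices {n : ℕ} {h : Fin (n + 1) → ℕ+} {w : Equiv.Perm (Fin (n + 1))}
    (hw : ¬ HasBlockPeak h w) (p : Fin (n + 1)) :
    (signChoices h w p).card * 2 ^ ((∑ a, if a.succ = p ∧ IsBlockAscent h w a then 1 else 0) +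
      ∑ a : Fin n, if a.castSucc = p ∧ IsBlockDescent h w a then 1 else 0) = 2 := by
  have hA : (∑ a, if a.succ = p ∧ IsBlockAscent h w a then 1 else 0) =
      if ∃ a, a.succ = p ∧ IsBlockAscent h w a then 1 else 0 := by
    split_ifs with hA
    · obtain ⟨a, ha⟩ := hA
      rw [Finset.sum_eq_single a, if_pos ha]
      · intro b _ hb
        rw [if_neg]
        exact fun hb' => hb (Fin.succ_injective _ (hb'.1.trans ha.1.symm))
      · simp
    · exact Finset.sum_eq_zero fun a _ => if_neg fun ha => hA ⟨a, ha⟩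
  have hD : (∑ a : Fin n, if a.castSucc = p ∧ IsBlockDescent h w a then 1 else 0) =
      if ∃ a, a.castSucc = p ∧ IsBlockDescent h w a then 1 else 0 := by
    split_ifs with hD
    · obtain ⟨a, ha⟩ := hD
      rw [Finset.sum_eq_single a, if_pos ha]
      · intro b _ hb
        rw [if_neg]
        exact fun hb' => hb (Fin.castSucc_injective _ (hb'.1.trans ha.1.symm))
      · simp
    · exact Finset.sum_eq_zero fun a _ => if_neg fun ha => hD ⟨a, ha⟩
  rw [hA, hD, signChoices]
  have hp : ¬ ((∃ a, a.succ = p ∧ IsBlockAscent h w a) ∧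
    ∃ a, a.castSucc = p ∧ IsBlockDescent h w a) := fun hp => hw ⟨p, hp⟩
  by_cases h1 : ∃ a, a.succ = p ∧ IsBlockAscent h w a <;>
    by_cases h2 : ∃ a, a.castSucc = p ∧ IsBlockDescent h w a
  · exact absurd ⟨h1, h2⟩ hp
  all_goals
    simp only [h1, h2, if_true, if_false, true_imp_iff, false_imp_iff, and_true, true_and]
    rfl

open Classical in
lemma prod_card_signChoices {n : ℕ} {h : Fin (n + 1) → ℕ+} {w : Equiv.Perm (Fin (n + 1))}
    (hw : ¬ HasBlockPeak h w) : (∏ p, (signChoices h w p).card) *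
      2 ^ (∑ a : Fin n, if h a.castSucc = h a.succ then 1 else 0) = 2 ^ (n + 1) := by
  -- Double counting: each adjacency inside a block is either an ascent or a descent, so it
  -- contributes one demand in all.
  have key : ∑ p, ((∑ a, if a.succ = p ∧ IsBlockAscent h w a then 1 else 0) +
      ∑ a : Fin n, if a.castSucc = p ∧ IsBlockDescent h w a then 1 else 0) =
      ∑ a : Fin n, if h a.castSucc = h a.succ then 1 else 0 := by
    rw [Finset.sum_add_distrib, Finset.sum_comm, Finset.sum_comm (s := Finset.univ (α := Fin (n+1))),
      ← Finset.sum_add_distrib]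
    refine Finset.sum_congr rfl fun a _ => ?_
    simp only [IsBlockAscent, IsBlockDescent]
    have hne : w a.castSucc ≠ w a.succ := w.injective.ne (Fin.castSucc_lt_succ).ne
    by_cases he : h a.castSucc = h a.succ <;> rcases lt_or_gt_of_ne hne with hlt | hlt <;>
      simp [he, hlt, hlt.not_gt]
  rw [← key, ← Finset.prod_pow_eq_pow_sum, ← Finset.prod_mul_distrib,
    Finset.prod_congr rfl fun p _ => card_signChoices hw p]
  simp

/-- With a block peak both products vanish; otherwise `prod_card_signChoices` determines them by a
formula in `h` alone. -/
lemma prod_card_signChoices_congr {n : ℕ} (h : Fin (n + 1) → ℕ+)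
    {w w' : Equiv.Perm (Fin (n + 1))} (hc : cPk w = cPk w') :
    ∏ p, (signChoices h w p).card = ∏ p, (signChoices h w' p).card := by
  classical
  have hzero : ∀ u : Equiv.Perm (Fin (n + 1)), HasBlockPeak h u →
      ∏ p, (signChoices h u p).card = 0 := by
    rintro u ⟨p, hp1, hp2⟩
    refine Finset.prod_eq_zero (Finset.mem_univ p) ?_
    rw [Finset.card_eq_zero, signChoices, Finset.filter_eq_empty_iff]
    rintro b - ⟨h1, h2⟩
    have := (h1 hp1).symm.trans (h2 hp2)
    exact absurd this (by decide)
  have hiff : HasBlockPeak h w ↔ HasBlockPeak h w' := by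
    rw [hasBlockPeak_iff, hasBlockPeak_iff, hc]
  by_cases hw : HasBlockPeak h w
  · rw [hzero w hw, hzero w' (hiff.1 hw)]
  · exact Nat.eq_of_mul_eq_mul_right (Nat.two_pow_pos _)
      ((prod_card_signChoices hw).trans (prod_card_signChoices (mt hiff.2 hw)).symm)

/-- Strict monotonicity of the keys need only be checked at adjacent positions, and at equal
absolute values each check involves one sign only. -/
lemma std_signed_iff {n : ℕ} (h : Fin (n + 1) → ℕ+) (w : Equiv.Perm (Fin (n + 1)))
    (ε : Fin (n + 1) → Bool) :
    std ((fun p => signed (ε p) (h p)) ∘ w.symm) = w ↔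
      (∀ a : Fin n, h a.castSucc ≤ h a.succ) ∧ ∀ p, ε p ∈ signChoices h w p := by
  have e : (∀ p, ε p ∈ signChoices h w p) ↔ ∀ a : Fin n,
      (IsBlockAscent h w a → ε a.succ = true) ∧
        (IsBlockDescent h w a → ε a.castSucc = false) := by
    simp only [signChoices, Finset.mem_filter, Finset.mem_univ, true_and]
    constructor
    · exact fun H a => ⟨fun ha => (H a.succ).1 ⟨a, rfl, ha⟩, fun ha => (H _).2 ⟨a, rfl, ha⟩⟩
    · rintro H p
      exact ⟨fun ⟨a, ha, ha'⟩ => ha ▸ (H a).1 ha', fun ⟨a, ha, ha'⟩ => ha ▸ (H a).2 ha'⟩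
  rw [← strictMono_key_iff, Fin.strictMono_iff_lt_succ, e, ← forall_and]
  refine forall_congr' fun a => ?_
  have hne : w a.castSucc ≠ w a.succ := w.injective.ne (Fin.castSucc_lt_succ).ne
  simp only [Function.comp, key_lt_iff, abs_signed, signed_pos_iff, Equiv.symm_apply_apply,
    IsBlockAscent, IsBlockDescent, le_iff_lt_or_eq, Fin.lt_def]
  rw [Ne, Fin.ext_iff] at hne
  rcases lt_trichotomy (h a.castSucc) (h a.succ) with hlt | heq | hlt
  · simp [hlt, hlt.ne]
  · simp only [heq, lt_irrefl, true_and, false_or, or_true]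
    cases ε a.castSucc <;> cases ε a.succ <;> simp <;> omega
  · simp [hlt.not_gt, hlt.ne']

lemma weight_comp_perm {n : ℕ} (f : Fin n → NonzeroInt) (w : Equiv.Perm (Fin n)) :
    weight (f ∘ w) = weight f :=
  Equiv.sum_comp w fun i => Finsupp.single (f i).abs 1

lemma weight_eq_of_abs_eq {n : ℕ} {f g : Fin n → NonzeroInt}
    (h : NonzeroInt.abs ∘ f = NonzeroInt.abs ∘ g) : weight f = weight g :=
  Finset.sum_congr rfl fun i _ => by rw [show (f i).abs = (g i).abs from congrFun h i]

open Classical in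
lemma card_std_eq_of_abs {n : ℕ} (h : Fin (n + 1) → ℕ+) (w : Equiv.Perm (Fin (n + 1)))
    (s : Finset (Fin (n + 1) → NonzeroInt))
    (hs : ∀ f, NonzeroInt.abs ∘ f ∘ w = h → f ∈ s) :
    (s.filter fun f => std f = w ∧ NonzeroInt.abs ∘ f ∘ w = h).card =
      if ∀ a : Fin n, h a.castSucc ≤ h a.succ then ∏ p, (signChoices h w p).card else 0 := by
  have e : (s.filter fun f => std f = w ∧ NonzeroInt.abs ∘ f ∘ w = h).card =
      (Finset.univ.filter fun ε : Fin (n + 1) → Bool =>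
        (∀ a : Fin n, h a.castSucc ≤ h a.succ) ∧ ∀ p, ε p ∈ signChoices h w p).card := by
    symm
    have habs : ∀ ε : Fin (n + 1) → Bool,
        NonzeroInt.abs ∘ ((fun p => signed (ε p) (h p)) ∘ w.symm) ∘ w = h := by
      intro ε
      funext p
      simp
    refine Finset.card_bij (fun ε _ => (fun p => signed (ε p) (h p)) ∘ w.symm) ?_ ?_ ?_
    · intro ε hε
      rw [Finset.mem_filter] at hε ⊢
      exact ⟨hs _ (habs ε), (std_signed_iff h w ε).2 hε.2, habs ε⟩
    · intro ε _ ε' _ hee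
      funext p
      have := congrArg (fun z => 0 < z.1) (congrFun hee (w p))
      simpa using this
    · intro f hf
      rw [Finset.mem_filter] at hf
      have hf' : (fun p => signed (decide (0 < (f (w p)).1)) (h p)) ∘ w.symm = f := by
        funext v
        refine NonzeroInt.ext_abs ?_ (by simp)
        simp [← hf.2.2]
      refine ⟨fun p => decide (0 < (f (w p)).1), ?_, hf'⟩
      rw [Finset.mem_filter, ← std_signed_iff, hf']
      exact ⟨Finset.mem_univ _, hf.2.1⟩
  rw [e, ← Fintype.card_piFinset]
  split_ifs with hmono
  · congr 1
    ext ε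
    simp [hmono]
  · simp [hmono]

lemma enumerator_std_eq_congr {n : ℕ} {w w' : Equiv.Perm (Fin n)} (hc : cPk w = cPk w') :
    enumerator {f | std f = w} = enumerator {f | std f = w'} := by
  classical
  obtain _ | n := n
  · rw [Subsingleton.elim w w']
  ext M
  -- The functions are grouped by their absolute values read along `u`. Reordering preserves the
  -- weight, so the range of summation does not depend on `u`.
  have key : ∀ u : Equiv.Perm (Fin (n + 1)),
      MvPowerSeries.coeff M (enumerator {f | std f = u}) =
        ((∑ h ∈ (finite_weight_eq (n := n + 1) M).toFinset.image (NonzeroInt.abs ∘ ·),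
          if ∀ a : Fin n, h a.castSucc ≤ h a.succ
            then ∏ p, (signChoices h u p).card else 0 : ℕ) : ℚ) := by
    intro u
    rw [coeff_enumerator, Nat.cast_inj,
      Finset.card_eq_sum_card_fiberwise (f := fun f => NonzeroInt.abs ∘ f ∘ u)
      (t := (finite_weight_eq (n := n + 1) M).toFinset.image (NonzeroInt.abs ∘ ·))]
    · refine Finset.sum_congr rfl fun h hh => ?_
      rw [← card_std_eq_of_abs h u (finite_weight_eq M).toFinset, Finset.filter_filter]
      · simp only [Set.mem_ofPred_eq]
      · intro f hf
        obtain ⟨g, hg, rfl⟩ := Finset.mem_image.1 hh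
        rw [Set.Finite.mem_toFinset, Set.mem_ofPred_eq] at hg ⊢
        rw [← weight_comp_perm f u, ← hg]
        exact weight_eq_of_abs_eq hf
    · intro f hf
      simp only [Finset.coe_filter, Set.Finite.mem_toFinset, Set.mem_ofPred_eq] at hf
      simp only [Finset.coe_image, Set.mem_image, Finset.mem_coe, Set.Finite.mem_toFinset,
        Set.mem_ofPred_eq]
      exact ⟨f ∘ u, by rw [weight_comp_perm, hf.1], rfl⟩
  simp only [key, prod_card_signChoices_congr _ hc]

/-- Rotations commute with the passage to a cyclic neighbour. Hence equal cyclic peak sets stay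
equal after rotating both permutations, which allows a term-by-term comparison over the coset. -/
lemma cPk_mul_rotation {n : ℕ} (w : Equiv.Perm (Fin n)) {g : Equiv.Perm (Fin n)}
    (hg : g ∈ rotations n) : cPk (w * g) = g ⁻¹' cPk w := by
  obtain ⟨k, rfl⟩ := mem_rotations.1 hg
  have h1 : Commute (finRotate n ^ k) (finRotate n) := (Commute.refl _).pow_left k
  have h2 : Commute (finRotate n ^ k) (finRotate n)⁻¹ := h1.inv_right
  ext i
  have e1 := DFunLike.congr_fun h1.eq i
  have e2 := DFunLike.congr_fun h2.eq i
  simp only [Equiv.Perm.mul_apply] at e1 e2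
  rw [Set.mem_preimage]
  simp only [cPk, Set.mem_ofPred_eq, Equiv.Perm.mul_apply]
  rw [e1]
  exact and_congr_left fun _ => Iff.of_eq (congrArg (w · < _) e2)

lemma toricEnumerator_congr {n : ℕ} {w w' : Equiv.Perm (Fin n)} (hc : cPk w = cPk w') :
    toricEnumerator (linearDAG w) = toricEnumerator (linearDAG w') := by
  classical
  rw [toricEnumerator_linearDAG, toricEnumerator_linearDAG]
  refine Finset.sum_congr rfl fun g hg => enumerator_std_eq_congr ?_
  rw [Finset.mem_filter] at hg
  rw [cPk_mul_rotation w hg.2, cPk_mul_rotation w' hg.2, hc]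

lemma KCyc_cPk {n : ℕ} (w : Equiv.Perm (Fin n)) :
    KCyc (cPk w) = toricEnumerator (linearDAG w) := by
  have h : IsCyclicPeakSet (cPk w) := ⟨w, rfl⟩
  rw [KCyc, dif_pos h]
  exact toricEnumerator_congr h.choose_spec

/-! ### The graded subring -/

lemma peakSpaceDeg_eq_span (n : ℕ) : peakSpaceDeg n =
    Submodule.span ℚ (Set.range fun w : Equiv.Perm (Fin n) => toricEnumerator (linearDAG w)) := by
  rw [peakSpaceDeg]
  congr 1
  ext K
  constructor
  · rintro ⟨_, ⟨w, rfl⟩, rfl⟩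
    exact ⟨w, (KCyc_cPk w).symm⟩
  · rintro ⟨w, rfl⟩
    exact ⟨cPk w, ⟨w, rfl⟩, (KCyc_cPk w).symm⟩

lemma peakSpaceDeg_le_cQSymDeg (n : ℕ) : peakSpaceDeg n ≤ cQSymDeg n := by
  rw [peakSpaceDeg_eq_span, Submodule.span_le]
  rintro _ ⟨w, rfl⟩
  exact ⟨isCyclicQuasiSymmetric_toricEnumerator w, isHomogeneous_toricEnumerator _⟩

lemma mul_mem_peakSpaceDeg {m n : ℕ} {f g : Series} (hf : f ∈ peakSpaceDeg m)
    (hg : g ∈ peakSpaceDeg n) : f * g ∈ peakSpaceDeg (m + n) := by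
  rw [peakSpaceDeg_eq_span] at hf hg ⊢
  have h := Submodule.mul_mem_mul hf hg
  rw [Submodule.span_mul_span] at h
  refine Submodule.span_le.2 ?_ h
  rintro _ ⟨_, ⟨u, rfl⟩, _, ⟨v, rfl⟩, rfl⟩
  exact toricEnumerator_mul_mem_span u v

lemma one_mem_peakSpaceDeg : (1 : Series) ∈ peakSpaceDeg 0 := by
  classical
  rw [peakSpaceDeg_eq_span]
  refine Submodule.subset_span ⟨1, ?_⟩
  ext M
  have hmem : ∀ f, f ∈ toricPartitions (linearDAG (1 : Equiv.Perm (Fin 0))) := fun f => by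
    rw [mem_toricPartitions_linearDAG, Subsingleton.elim (_ * _) 1]
    exact one_mem _
  simp only [toricEnumerator_eq_enumerator, coeff_enumerator, hmem, MvPowerSeries.coeff_one,
    Finset.filter_true]
  have hw : ∀ f : Fin 0 → NonzeroInt, weight f = 0 := fun f => by simp [weight]
  split_ifs with hM
  · norm_cast
    rw [Finset.card_eq_one]
    exact ⟨default, by ext f; simp [hw, hM, Subsingleton.elim f default]⟩
  · norm_cast
    rw [Finset.card_eq_zero, Finset.eq_empty_iff_forall_notMem]
    intro f
    simp [hw, eq_comm, hM]

instance gradedMonoid_peakSpaceDeg : SetLike.GradedMonoid peakSpaceDeg where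
  one_mem := one_mem_peakSpaceDeg
  mul_mem _ _ _ _ := mul_mem_peakSpaceDeg

lemma peakSpace_le_cQSym : peakSpace ≤ Subalgebra.toSubmodule cQSym :=
  iSup_mono peakSpaceDeg_le_cQSymDeg

lemma mul_mem_peakSpace {f g : Series} (hf : f ∈ peakSpace) (hg : g ∈ peakSpace) :
    f * g ∈ peakSpace := by
  have h := Submodule.mul_mem_mul hf hg
  rw [peakSpace, Submodule.iSup_mul] at h
  refine (iSup_le fun m => ?_ : _ ≤ ⨆ n, peakSpaceDeg n) h
  rw [Submodule.mul_iSup]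
  refine iSup_le fun n => ?_
  rw [Submodule.mul_le]
  intro p hp q hq
  exact Submodule.mem_iSup_of_mem (m + n) (mul_mem_peakSpaceDeg hp hq)

/-- `Λ` as a subalgebra of the algebra of formal power series. -/
noncomputable def peakAlgebra : Subalgebra ℚ Series :=
  peakSpace.toSubalgebra (Submodule.mem_iSup_of_mem 0 one_mem_peakSpaceDeg)
    fun _ _ => mul_mem_peakSpace

lemma map_comap_peakAlgebra :
    Subalgebra.toSubmodule ((peakAlgebra.comap cQSym.val).map cQSym.val) = peakSpace := by
  ext f
  rw [Subalgebra.mem_toSubmodule, Subalgebra.mem_map]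
  constructor
  · rintro ⟨x, hx, rfl⟩
    exact hx
  · intro hf
    exact ⟨⟨f, peakSpace_le_cQSym hf⟩, hf, rfl⟩

end CyclicPeak

theorem mainTheorem2 :
    -- `K^cyc_S` does not depend on the permutation with cyclic peak set `S`
    (∀ (n : ℕ) (w : Equiv.Perm (Fin n)),
      CyclicPeak.KCyc (CyclicPeak.cPk w) =
        CyclicPeak.toricEnumerator (CyclicPeak.linearDAG w)) ∧
    -- `Λ` is a subring (and a linear subspace) of `cQSym`
    (∃ A : Subalgebra ℚ CyclicPeak.cQSym,
      Subalgebra.toSubmodule (A.map CyclicPeak.cQSym.val) = CyclicPeak.peakSpace) ∧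
    -- graded: `Λ` is the direct sum of the `Λ_n`, with `Λ_n ⊆ cQSym_n`,
    -- `1 ∈ Λ_0` and `Λ_m Λ_n ⊆ Λ_{m+n}`
    iSupIndep CyclicPeak.peakSpaceDeg ∧
    (∀ n : ℕ, CyclicPeak.peakSpaceDeg n ≤ CyclicPeak.cQSymDeg n) ∧
    SetLike.GradedMonoid CyclicPeak.peakSpaceDeg :=
  ⟨fun _ w => CyclicPeak.KCyc_cPk w, ⟨_, CyclicPeak.map_comap_peakAlgebra⟩,
    CyclicPeak.iSupIndep_cQSymDeg.mono CyclicPeak.peakSpaceDeg_le_cQSymDeg,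
    CyclicPeak.peakSpaceDeg_le_cQSymDeg, CyclicPeak.gradedMonoid_peakSpaceDeg⟩
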